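/- **Setting.** A market consists of finite sets $\mathscr B$ of buyers and $\mathscr S$ of sellers, an arbitrary bipartite graph $E\subseteq \mathscr B\times\mathscr S$ of pairs that may trade, and a valuation $val(Z)\in[0,1]$ of every player $Z$. Let $n=|\mathscr B|+|\mathscr S|$. A state $(P,\Pi)$ consists of a price $P(Z)$ for every player (a bid of a buyer, an offer of a seller) and a matching $\Pi$. It is *valid* if $P(B)\le val(B)$ for all buyers, $P(S)\ge val(S)$ for all sellers, and every $(B,S)\in\Pi$ satisfies $(B,S)\in E$ and $P(B)\ge P(S)$. Fix $\epsilon>0$. All submitted prices are integer multiples of $\epsilon$ in the price range $[0,1]$ (if $1$ is not a multiple of $\epsilon$, in $[0,\lceil 1/\epsilon\rceil\epsilon]$). Accordingly, let $\overline{val}(B)=\lfloor val(B)/\epsilon\rfloor\epsilon$ for buyers and $\overline{val}(S)=\lceil val(S)/\epsilon\rceil\epsilon$ for sellers; this is $val$ itself if all valuations are multiples of $\epsilon$. A state is *$\epsilon$-stable* if $P(B)-P(S)\le\epsilon$ for all $(B,S)\in E$, $P(Z)=\overline{val}(Z)$ for every unmatched $Z$, and $P(B)=P(S)$ for all $(B,S)\in\Pi$.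 A *valid starting state* is a valid state with such prices in which $P(B)\le P(S)$ for all $(B,S)\in E$. **Interest and increments.** For $(B,S)\in E$, the seller $S$ is *interested* in $B$ if either $S$ is unmatched and $P(B)\ge P(S)$, or $S$ is matched and $P(B)-P(S)\ge\epsilon$; likewise for $B$ being interested in $S$. A buyer $B$ *may raise* his bid to $P(B)+\epsilon$ if this is at most $val(B)$, at most $P(S)+\epsilon$ for every neighbour $S$, and at most $P(S)$ for every unmatched neighbour $S$. Symmetrically, a seller $S$ *may lower* his offer to $P(S)-\epsilon$ if this is at least $val(S)$, at least $P(B)-\epsilon$ for every neighbour $B$, and at least $P(B)$ for every unmatched neighbour $B$. **The mechanism.** An unmatched player who may not change his price and in whom nobody is interested is labeled *inactive* (at the start and after every step); he keeps this label until somebody matches with him. All other unmatched players are *active*. In each step one of the active players is recognized uniformly at random; if there is none, the mechanism has stopped. A recognized buyer $B$ either raises his bid by $\epsilon$, if he may, or is matched with a seller $S$ interested in him, who has to be unmatched if some unmatched seller is interested in $B$; then the former partner of $S$, if any, becomes unmatched and $P(S)$ is raised to $P(B)$. Recognized sellers act symmetrically (the offer is lowered by $\epsilon$; on matching, $P(B)$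 is lowered to $P(S)$). Where these rules leave a choice, it is made arbitrarily, possibly at random and depending on the whole past. **Theorem.** There is an absolute constant $C>0$ such that for every market, every $\epsilon>0$, every valid starting state and every behaviour of the players that obeys the rules: 1. the probability that within $t$ steps the mechanism has stopped in a valid $\epsilon$-stable state tends to $1$ as $t\to\infty$; 2. if $n\ge 2$, then for every $t\ge C\,\dfrac{n^3}{\min(\epsilon,1)^2}\log n$, with probability at least $1-\dfrac1n$ the mechanism has stopped in a valid $\epsilon$-stable state within $t$ steps. In particular, for $0<\epsilon\le 1$ it converges to an $\epsilon$-stable state within $O((n^3/\epsilon^2)\log n)$ steps with high probability. -/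

import Mathlib

open Filter Topology
open scoped ENNReal

noncomputable section

namespace DoubleAuction

universe u v

/-- A market: buyers `𝓑`, sellers `𝓢`, an arbitrary bipartite trading graph, and the valuations
of the buyers and (opportunity costs) of the sellers. -/
@[ext]
structure Market (𝓑 : Type u) (𝓢 : Type v) where
  Adj : 𝓑 → 𝓢 → Prop
  valB : 𝓑 → ℝ
  valS : 𝓢 → ℝ

/-- All valuations lie in `[0,1]`. -/
def Market.UnitValuations {𝓑 : Type u} {𝓢 : Type v} (G : Market 𝓑 𝓢) : Prop :=
  (∀ b, G.valB b ∈ Set.Icc (0 : ℝ) 1) ∧ (∀ s, G.valS s ∈ Set.Icc (0 : ℝ) 1)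

/-- The market in which each valuation is replaced by the best price that the agent may submit
when prices are multiples of `ε`: a buyer's valuation is rounded down to a multiple of `ε`,
a seller's opportunity cost is rounded up. -/
def Market.onGrid {𝓑 : Type u} {𝓢 : Type v} (G : Market 𝓑 𝓢) (ε : ℝ) : Market 𝓑 𝓢 where
  Adj := G.Adj
  valB := fun b => (⌊G.valB b / ε⌋ : ℝ) * ε
  valS := fun s => (⌈G.valS s / ε⌉ : ℝ) * ε

/-- Rounding changes nothing when the valuations are multiples of `ε`. -/
theorem Market.onGrid_eq_self {𝓑 : Type u} {𝓢 : Type v} (G : Market 𝓑 𝓢) {ε : ℝ} (hε : 0 < ε)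
    (hB : ∀ b, ∃ k : ℤ, G.valB b = k * ε) (hS : ∀ s, ∃ k : ℤ, G.valS s = k * ε) :
    G.onGrid ε = G := by
  ext x
  · rfl
  · obtain ⟨k, hk⟩ := hB x
    simp [Market.onGrid, hk, hε.ne']
  · obtain ⟨k, hk⟩ := hS x
    simp [Market.onGrid, hk, hε.ne']

/-- A market state: the submitted prices and a matching of buyers and sellers. -/
structure MarketState (𝓑 : Type u) (𝓢 : Type v) where
  bid : 𝓑 → ℝ
  offer : 𝓢 → ℝ
  paired : 𝓑 → 𝓢 → Prop
  seller_unique : ∀ b s s', paired b s → paired b s' → s = s'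
  buyer_unique : ∀ b b' s, paired b s → paired b' s → b = b'

namespace MarketState

variable {𝓑 : Type u} {𝓢 : Type v}

def MatchedB (x : MarketState 𝓑 𝓢) (b : 𝓑) : Prop := ∃ s, x.paired b s

def MatchedS (x : MarketState 𝓑 𝓢) (s : 𝓢) : Prop := ∃ b, x.paired b s

/-- Valid states. -/
def IsValid (x : MarketState 𝓑 𝓢) (G : Market 𝓑 𝓢) : Prop :=
  (∀ b, x.bid b ≤ G.valB b) ∧ (∀ s, G.valS s ≤ x.offer s) ∧
  (∀ b s, x.paired b s → G.Adj b s) ∧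
  (∀ b s, x.paired b s → x.offer s ≤ x.bid b)

/-- `ε`-stable states. -/
def IsEpsStable (x : MarketState 𝓑 𝓢) (G : Market 𝓑 𝓢) (ε : ℝ) : Prop :=
  (∀ b s, G.Adj b s → x.bid b - x.offer s ≤ ε) ∧
  ((∀ b, ¬ x.MatchedB b → x.bid b = G.valB b) ∧
    (∀ s, ¬ x.MatchedS s → x.offer s = G.valS s)) ∧
  (∀ b s, x.paired b s → x.bid b = x.offer s)

/-- All submitted prices are multiples of `ε` in the price range `[0,1]`; when `1` is not
a multiple of `ε`, the upper end is the first multiple of `ε` above `1`. -/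
def PricesOnGrid (x : MarketState 𝓑 𝓢) (ε : ℝ) : Prop :=
  (∀ b, (∃ k : ℤ, x.bid b = k * ε) ∧ x.bid b ∈ Set.Icc 0 ((⌈1 / ε⌉ : ℝ) * ε)) ∧
  (∀ s, (∃ k : ℤ, x.offer s = k * ε) ∧ x.offer s ∈ Set.Icc 0 ((⌈1 / ε⌉ : ℝ) * ε))

/-- Valid starting states of the mechanism with parameter `ε`. -/
def IsValidStart (x : MarketState 𝓑 𝓢) (G : Market 𝓑 𝓢) (ε : ℝ) : Prop :=
  x.IsValid G ∧ x.PricesOnGrid ε ∧ ∀ b s, G.Adj b s → x.bid b ≤ x.offer s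

/-- Seller `s` is `ε`-interested in buyer `b`. -/
def SellerInterested (x : MarketState 𝓑 𝓢) (G : Market 𝓑 𝓢) (ε : ℝ) (s : 𝓢) (b : 𝓑) : Prop :=
  G.Adj b s ∧
    ((¬ x.MatchedS s ∧ x.offer s ≤ x.bid b) ∨ (x.MatchedS s ∧ ε ≤ x.bid b - x.offer s))

/-- Buyer `b` is `ε`-interested in seller `s`. -/
def BuyerInterested (x : MarketState 𝓑 𝓢) (G : Market 𝓑 𝓢) (ε : ℝ) (b : 𝓑) (s : 𝓢) : Prop :=
  G.Adj b s ∧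
    ((¬ x.MatchedB b ∧ x.offer s ≤ x.bid b) ∨ (x.MatchedB b ∧ ε ≤ x.bid b - x.offer s))

/-- Buyer `b` may raise his bid by `ε`: the new bid does not exceed his valuation, nor (increment
rule) the lowest neighbouring offer plus `ε`, nor the lowest offer of an unmatched neighbour. -/
def CanRaise (x : MarketState 𝓑 𝓢) (G : Market 𝓑 𝓢) (ε : ℝ) (b : 𝓑) : Prop :=
  x.bid b + ε ≤ G.valB b ∧
  ∀ s, G.Adj b s → x.bid b + ε ≤ x.offer s + ε ∧ (¬ x.MatchedS s → x.bid b + ε ≤ x.offer s)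

/-- Seller `s` may lower his offer by `ε`. -/
def CanLower (x : MarketState 𝓑 𝓢) (G : Market 𝓑 𝓢) (ε : ℝ) (s : 𝓢) : Prop :=
  G.valS s ≤ x.offer s - ε ∧
  ∀ b, G.Adj b s → x.bid b - ε ≤ x.offer s - ε ∧ (¬ x.MatchedB b → x.bid b ≤ x.offer s - ε)

/-- An unmatched buyer who neither submits a new bid (submitting whenever he may) nor has
an interested seller. -/
def IdleB (x : MarketState 𝓑 𝓢) (G : Market 𝓑 𝓢) (ε : ℝ) (b : 𝓑) : Prop :=
  ¬ x.MatchedB b ∧ ¬ x.CanRaise G ε b ∧ ¬ ∃ s, x.SellerInterested G ε s b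

/-- An unmatched seller who neither submits a new offer nor has an interested buyer. -/
def IdleS (x : MarketState 𝓑 𝓢) (G : Market 𝓑 𝓢) (ε : ℝ) (s : 𝓢) : Prop :=
  ¬ x.MatchedS s ∧ ¬ x.CanLower G ε s ∧ ¬ ∃ b, x.BuyerInterested G ε b s

open Classical in
/-- Buyer `b` raises his bid by `ε`. -/
def raiseBid (x : MarketState 𝓑 𝓢) (ε : ℝ) (b : 𝓑) : MarketState 𝓑 𝓢 :=
  { x with bid := Function.update x.bid b (x.bid b + ε) }

open Classical in
/-- Seller `s` lowers his offer by `ε`. -/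
def lowerOffer (x : MarketState 𝓑 𝓢) (ε : ℝ) (s : 𝓢) : MarketState 𝓑 𝓢 :=
  { x with offer := Function.update x.offer s (x.offer s - ε) }

open Classical in
/-- Match `b` with `s` at price `p`; the former partners of `b` and `s` become unmatched. -/
def pairUp (x : MarketState 𝓑 𝓢) (b : 𝓑) (s : 𝓢) (p : ℝ) : MarketState 𝓑 𝓢 where
  bid := Function.update x.bid b p
  offer := Function.update x.offer s p
  paired := fun b' s' => (b' = b ∧ s' = s) ∨ (b' ≠ b ∧ s' ≠ s ∧ x.paired b' s')
  seller_unique := by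
    rintro b₁ s₁ s₂ (⟨h, h1⟩ | ⟨h, h1, h2⟩) (⟨k, k1⟩ | ⟨k, k1, k2⟩)
    · rw [h1, k1]
    · exact absurd h k
    · exact absurd k h
    · exact x.seller_unique _ _ _ h2 k2
  buyer_unique := by
    rintro b₁ b₂ s₁ (⟨h, h1⟩ | ⟨h, h1, h2⟩) (⟨k, k1⟩ | ⟨k, k1, k2⟩)
    · rw [h, k]
    · exact absurd h1 k1
    · exact absurd k1 h1
    · exact x.buyer_unique _ _ _ h2 k2

/-- `y` is a possible result of recognizing buyer `b` in `x`: either `b` raises his bid by `ε`,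
or he is matched with an interested seller (an unmatched one if there is one), whose offer
is raised to the bid of `b`. -/
def BuyerMove (x : MarketState 𝓑 𝓢) (G : Market 𝓑 𝓢) (ε : ℝ) (b : 𝓑)
    (y : MarketState 𝓑 𝓢) : Prop :=
  (x.CanRaise G ε b ∧ y = x.raiseBid ε b) ∨
  ∃ s, x.SellerInterested G ε s b ∧
    ((∃ s', x.SellerInterested G ε s' b ∧ ¬ x.MatchedS s') → ¬ x.MatchedS s) ∧
    y = x.pairUp b s (x.bid b)

/-- `y` is a possible result of recognizing seller `s` in `x`: either `s` lowers his offer by `ε`,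
or he is matched with an interested buyer (an unmatched one if there is one), whose bid
is lowered to the offer of `s`. -/
def SellerMove (x : MarketState 𝓑 𝓢) (G : Market 𝓑 𝓢) (ε : ℝ) (s : 𝓢)
    (y : MarketState 𝓑 𝓢) : Prop :=
  (x.CanLower G ε s ∧ y = x.lowerOffer ε s) ∨
  ∃ b, x.BuyerInterested G ε b s ∧
    ((∃ b', x.BuyerInterested G ε b' s ∧ ¬ x.MatchedB b') → ¬ x.MatchedB b) ∧
    y = x.pairUp b s (x.offer s)

end MarketState

/-- A market state together with the players currently labeled inactive. -/
structure Config (𝓑 : Type u) (𝓢 : Type v) where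
  state : MarketState 𝓑 𝓢
  inactiveB : Set 𝓑
  inactiveS : Set 𝓢

namespace Config

variable {𝓑 : Type u} {𝓢 : Type v}

/-- The starting configuration: exactly the idle unmatched players are inactive. -/
def start (G : Market 𝓑 𝓢) (ε : ℝ) (x : MarketState 𝓑 𝓢) : Config 𝓑 𝓢 where
  state := x
  inactiveB := {b | x.IdleB G ε b}
  inactiveS := {s | x.IdleS G ε s}

/-- The configuration after the market state has changed from `c.state` to `y`: inactive players
stay inactive until they get matched, and idle unmatched players become inactive. -/
def next (c : Config 𝓑 𝓢) (G : Market 𝓑 𝓢) (ε : ℝ) (y : MarketState 𝓑 𝓢) : Config 𝓑 𝓢 where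
  state := y
  inactiveB := {b | ¬ y.MatchedB b ∧ (b ∈ c.inactiveB ∨ y.IdleB G ε b)}
  inactiveS := {s | ¬ y.MatchedS s ∧ (s ∈ c.inactiveS ∨ y.IdleS G ε s)}

/-- The active players are the unmatched players that are not labeled inactive. -/
def IsActive (c : Config 𝓑 𝓢) : 𝓑 ⊕ 𝓢 → Prop
  | Sum.inl b => ¬ c.state.MatchedB b ∧ b ∉ c.inactiveB
  | Sum.inr s => ¬ c.state.MatchedS s ∧ s ∉ c.inactiveS

open Classical in
def activePlayers [Fintype 𝓑] [Fintype 𝓢] (c : Config 𝓑 𝓢) : Finset (𝓑 ⊕ 𝓢) :=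
  Finset.univ.filter c.IsActive

/-- `c'` is a possible configuration after player `z` has been recognized in `c`. -/
def Move (c : Config 𝓑 𝓢) (G : Market 𝓑 𝓢) (ε : ℝ) (z : 𝓑 ⊕ 𝓢) (c' : Config 𝓑 𝓢) : Prop :=
  ∃ y : MarketState 𝓑 𝓢,
    (match z with
      | Sum.inl b => c.state.BuyerMove G ε b y
      | Sum.inr s => c.state.SellerMove G ε s y) ∧
    c' = c.next G ε y

/-- Every idle player is labeled inactive, as the activity rule demands. This holds in every
configuration of a run, see `labeled_start` and `labeled_next`. -/
def Labeled (c : Config 𝓑 𝓢) (G : Market 𝓑 𝓢) (ε : ℝ) : Prop :=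
  (∀ b, c.state.IdleB G ε b → b ∈ c.inactiveB) ∧ (∀ s, c.state.IdleS G ε s → s ∈ c.inactiveS)

theorem labeled_start (G : Market 𝓑 𝓢) (ε : ℝ) (x : MarketState 𝓑 𝓢) :
    (start G ε x).Labeled G ε :=
  ⟨fun _ h => h, fun _ h => h⟩

theorem labeled_next (c : Config 𝓑 𝓢) (G : Market 𝓑 𝓢) (ε : ℝ) (y : MarketState 𝓑 𝓢) :
    (c.next G ε y).Labeled G ε :=
  ⟨fun _ h => ⟨h.1, Or.inr h⟩, fun _ h => ⟨h.1, Or.inr h⟩⟩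

/-- Every active player of a correctly labeled configuration has a move. -/
theorem exists_move (c : Config 𝓑 𝓢) (G : Market 𝓑 𝓢) (ε : ℝ) (hc : c.Labeled G ε)
    (z : 𝓑 ⊕ 𝓢) (hz : c.IsActive z) : ∃ c', c.Move G ε z c' := by
  rcases z with b | s
  · have h : ¬ c.state.IdleB G ε b := fun h => hz.2 (hc.1 b h)
    suffices ∃ y, c.state.BuyerMove G ε b y by
      obtain ⟨y, hy⟩ := this
      exact ⟨_, y, hy, rfl⟩
    by_cases h1 : c.state.CanRaise G ε b
    · exact ⟨_, Or.inl ⟨h1, rfl⟩⟩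
    have h2 : ∃ s, c.state.SellerInterested G ε s b := by
      by_contra h2
      exact h ⟨hz.1, h1, h2⟩
    by_cases h3 : ∃ s, c.state.SellerInterested G ε s b ∧ ¬ c.state.MatchedS s
    · obtain ⟨s, hs, hs'⟩ := h3
      exact ⟨_, Or.inr ⟨s, hs, fun _ => hs', rfl⟩⟩
    · obtain ⟨s, hs⟩ := h2
      exact ⟨_, Or.inr ⟨s, hs, fun h4 => absurd h4 h3, rfl⟩⟩
  · have h : ¬ c.state.IdleS G ε s := fun h => hz.2 (hc.2 s h)
    suffices ∃ y, c.state.SellerMove G ε s y by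
      obtain ⟨y, hy⟩ := this
      exact ⟨_, y, hy, rfl⟩
    by_cases h1 : c.state.CanLower G ε s
    · exact ⟨_, Or.inl ⟨h1, rfl⟩⟩
    have h2 : ∃ b, c.state.BuyerInterested G ε b s := by
      by_contra h2
      exact h ⟨hz.1, h1, h2⟩
    by_cases h3 : ∃ b, c.state.BuyerInterested G ε b s ∧ ¬ c.state.MatchedB b
    · obtain ⟨b, hb, hb'⟩ := h3
      exact ⟨_, Or.inr ⟨b, hb, fun _ => hb', rfl⟩⟩
    · obtain ⟨b, hb⟩ := h2
      exact ⟨_, Or.inr ⟨b, hb, fun h4 => absurd h4 h3, rfl⟩⟩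

end Config

/-- The past of a run: earlier configurations with the player recognized there, latest first. -/
abbrev History (𝓑 : Type u) (𝓢 : Type v) := List (Config 𝓑 𝓢 × (𝓑 ⊕ 𝓢))

/-- The behaviour of the players: given the past, the current configuration and the recognized
player, a (possibly randomized) choice of the next configuration. -/
abbrev Behaviour (𝓑 : Type u) (𝓢 : Type v) :=
  History 𝓑 𝓢 → Config 𝓑 𝓢 → 𝓑 ⊕ 𝓢 → PMF (Config 𝓑 𝓢)

variable {𝓑 : Type u} {𝓢 : Type v}

/-- Every active player, when recognized, makes a move that the mechanism allows. -/
def Behaviour.Obeys (σ : Behaviour 𝓑 𝓢) (G : Market 𝓑 𝓢) (ε : ℝ) : Prop :=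
  ∀ h c z, c.Labeled G ε → c.IsActive z → ∀ c' ∈ (σ h c z).support, c.Move G ε z c'

theorem Behaviour.exists_obeys (G : Market 𝓑 𝓢) (ε : ℝ) :
    ∃ σ : Behaviour 𝓑 𝓢, σ.Obeys G ε := by
  classical
  refine ⟨fun _ c z => if h : ∃ c', c.Move G ε z c' then PMF.pure h.choose else PMF.pure c, ?_⟩
  intro _ c z hc hz c' hc'
  have h := c.exists_move G ε hc z hz
  simp only [h, dite_true, PMF.support_pure, Set.mem_singleton_iff] at hc'
  exact hc' ▸ h.choose_spec

open Classical in
/-- The law of the past and the current configuration after `t` steps: in each step one of the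
active players is recognized uniformly at random and moves; nothing happens any more when there
is no active player. -/
def runLaw [Fintype 𝓑] [Fintype 𝓢] (σ : Behaviour 𝓑 𝓢) (c₀ : Config 𝓑 𝓢) :
    ℕ → PMF (History 𝓑 𝓢 × Config 𝓑 𝓢)
  | 0 => PMF.pure ([], c₀)
  | t + 1 => (runLaw σ c₀ t).bind fun hc =>
      if hne : hc.2.activePlayers.Nonempty then
        (PMF.uniformOfFinset hc.2.activePlayers hne).bind fun z =>
          (σ hc.1 hc.2 z).map fun c' => ((hc.2, z) :: hc.1, c')
      else PMF.pure hc

/-- The law of the configuration after `t` steps. -/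
def configLaw [Fintype 𝓑] [Fintype 𝓢] (σ : Behaviour 𝓑 𝓢) (c₀ : Config 𝓑 𝓢) (t : ℕ) :
    PMF (Config 𝓑 𝓢) :=
  (runLaw σ c₀ t).map Prod.snd

/-- The configurations in which the mechanism has come to rest (no player is active) in a valid
`ε`-stable state, the valuations being read on the price grid. -/
def Converged [Fintype 𝓑] [Fintype 𝓢] (G : Market 𝓑 𝓢) (ε : ℝ) : Set (Config 𝓑 𝓢) :=
  {c | c.activePlayers = ∅ ∧ c.state.IsValid G ∧ c.state.IsEpsStable (G.onGrid ε) ε}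

end DoubleAuction

end

/-! The argument compares the mechanism with a random walk. Along a run, prices stay on the grid, a
bid exceeds a neighbouring offer by at most `ε`, matched pairs trade at equal prices, and inactive
players sit at their rounded valuations. Hence a configuration without active players is
automatically valid and stable (`Regular.converged`), and only the stopping time needs a bound.

Let `p` and `q` count the active buyers and sellers. Neither ever grows: a displaced player replaces
the one who displaced him. A move either lowers `p + q` or changes the sum of all prices by exactly
`ε`, upwards for a buyer and downwards for a seller (`Regular.move`). While `p` and `q` are
constant, the price sum in units of `ε` is therefore a walk on `[0, M]`, with `M = n⌈1/ε⌉`, going up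
with probability `p / (p + q)`, whatever the players choose.

If `q ≤ p`, the expected square of the level grows by at least 1 per step; otherwise the square of
its distance from `M` does. Normalised to `[0, 1]`, this yields a Lyapunov term falling by `1 / (M +
1) ^ 2` in expectation (`walkPotential_drift`). A drop of `p + q` by one pays for any jump of this
term, so `p + q` plus the term is a supermartingale with that drift. It is at most `n + 1`, so the
drift is also a contraction by `1 - 1 / D` with `D = (n + 1) * (M + 1) ^ 2`. It is at least 1 until
the mechanism stops, and Markov's inequality finishes. -/

namespace DoubleAuction

universe u v

variable {𝓑 : Type u} {𝓢 : Type v}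

/-! ### Invariants of market states. -/

namespace MarketState

/-- The properties of market states that every move of an unmatched player preserves. -/
structure Regular (x : MarketState 𝓑 𝓢) (G : Market 𝓑 𝓢) (ε : ℝ) : Prop where
  valid : x.IsValid G
  grid : x.PricesOnGrid ε
  gap : ∀ b s, G.Adj b s → x.bid b - x.offer s ≤ ε
  eq_of_paired : ∀ b s, x.paired b s → x.bid b = x.offer s

theorem IsValidStart.regular {x : MarketState 𝓑 𝓢} {G : Market 𝓑 𝓢} {ε : ℝ} (hε : 0 < ε)
    (h : x.IsValidStart G ε) : x.Regular G ε where
  valid := h.1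
  grid := h.2.1
  gap b s hbs := by linarith [h.2.2 b s hbs]
  eq_of_paired b s hbs := le_antisymm (h.2.2 b s (h.1.2.2.1 b s hbs)) (h.1.2.2.2 b s hbs)

theorem add_le_of_grid_lt {ε p q : ℝ} (hε : 0 < ε) (hp : ∃ k : ℤ, p = k * ε)
    (hq : ∃ k : ℤ, q = k * ε) (h : p < q) : p + ε ≤ q := by
  obtain ⟨k, rfl⟩ := hp
  obtain ⟨l, rfl⟩ := hq
  have h1 : k < l := by exact_mod_cast lt_of_mul_lt_mul_right h hε.le
  have h2 : (k : ℝ) + 1 ≤ l := by exact_mod_cast h1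
  nlinarith

theorem one_le_ceil_mul {ε : ℝ} (hε : 0 < ε) : 1 ≤ (⌈1 / ε⌉ : ℝ) * ε := by
  rw [← div_le_iff₀ hε]
  exact Int.le_ceil _

theorem Regular.raiseBid {x : MarketState 𝓑 𝓢} {G : Market 𝓑 𝓢} {ε : ℝ} (hε : 0 < ε)
    (hG : G.UnitValuations) (hx : x.Regular G ε) {b : 𝓑} (hb : ¬ x.MatchedB b)
    (h : x.CanRaise G ε b) : (x.raiseBid ε b).Regular G ε where
  valid := by
    refine ⟨fun b' => ?_, hx.valid.2.1, hx.valid.2.2.1, fun b' s' hp => ?_⟩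
    · by_cases hb' : b' = b
      · subst hb'
        simpa [MarketState.raiseBid] using h.1
      · simpa [MarketState.raiseBid, hb'] using hx.valid.1 b'
    · have hb' : b' ≠ b := fun e => hb ⟨s', e ▸ hp⟩
      simpa [MarketState.raiseBid, hb'] using hx.valid.2.2.2 b' s' hp
  grid := by
    refine ⟨fun b' => ?_, hx.grid.2⟩
    by_cases hb' : b' = b
    · subst hb'
      obtain ⟨⟨k, hk⟩, h0, -⟩ := hx.grid.1 b'
      have h1 := h.1
      have h2 := (hG.1 b').2
      have h3 := one_le_ceil_mul hε
      simp only [MarketState.raiseBid, Function.update_self]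
      exact ⟨⟨k + 1, by rw [hk]; push_cast; ring⟩, by linarith, by linarith⟩
    · simpa [MarketState.raiseBid, hb'] using hx.grid.1 b'
  gap b' s' hp := by
    by_cases hb' : b' = b
    · subst hb'
      have := (h.2 s' hp).1
      simp only [MarketState.raiseBid, Function.update_self]
      linarith
    · simpa [MarketState.raiseBid, hb'] using hx.gap b' s' hp
  eq_of_paired b' s' hp := by
    have hb' : b' ≠ b := fun e => hb ⟨s', e ▸ hp⟩
    simpa [MarketState.raiseBid, hb'] using hx.eq_of_paired b' s' hp

theorem Regular.lowerOffer {x : MarketState 𝓑 𝓢} {G : Market 𝓑 𝓢} {ε : ℝ} (hε : 0 < ε)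
    (hG : G.UnitValuations) (hx : x.Regular G ε) {s : 𝓢} (hs : ¬ x.MatchedS s)
    (h : x.CanLower G ε s) : (x.lowerOffer ε s).Regular G ε where
  valid := by
    refine ⟨hx.valid.1, fun s' => ?_, hx.valid.2.2.1, fun b' s' hp => ?_⟩
    · by_cases hs' : s' = s
      · subst hs'
        simpa [MarketState.lowerOffer] using h.1
      · simpa [MarketState.lowerOffer, hs'] using hx.valid.2.1 s'
    · have hs' : s' ≠ s := fun e => hs ⟨b', e ▸ hp⟩
      simpa [MarketState.lowerOffer, hs'] using hx.valid.2.2.2 b' s' hp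
  grid := by
    refine ⟨hx.grid.1, fun s' => ?_⟩
    by_cases hs' : s' = s
    · subst hs'
      obtain ⟨⟨k, hk⟩, -, h0⟩ := hx.grid.2 s'
      have h1 := h.1
      have h2 := (hG.2 s').1
      simp only [MarketState.lowerOffer, Function.update_self]
      exact ⟨⟨k - 1, by rw [hk]; push_cast; ring⟩, by linarith, by linarith⟩
    · simpa [MarketState.lowerOffer, hs'] using hx.grid.2 s'
  gap b' s' hp := by
    by_cases hs' : s' = s
    · subst hs'
      have := (h.2 b' hp).1
      simp only [MarketState.lowerOffer, Function.update_self]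
      linarith
    · simpa [MarketState.lowerOffer, hs'] using hx.gap b' s' hp
  eq_of_paired b' s' hp := by
    have hs' : s' ≠ s := fun e => hs ⟨b', e ▸ hp⟩
    simpa [MarketState.lowerOffer, hs'] using hx.eq_of_paired b' s' hp

/-- Because `p` lies between the offer of `s` and the bid of `b`, bids only fall and offers only
rise. This preserves the valuation constraints and the gap bound. -/
theorem Regular.pairUp {x : MarketState 𝓑 𝓢} {G : Market 𝓑 𝓢} {ε : ℝ}
    (hx : x.Regular G ε) {b : 𝓑} {s : 𝓢} {p : ℝ} (hbs : G.Adj b s)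
    (hp : (∃ k : ℤ, p = k * ε) ∧ p ∈ Set.Icc 0 ((⌈1 / ε⌉ : ℝ) * ε))
    (hpb : p ≤ x.bid b) (hps : x.offer s ≤ p) : (x.pairUp b s p).Regular G ε := by
  have hbid : ∀ b', (x.pairUp b s p).bid b' ≤ x.bid b' := fun b' => by
    by_cases hb' : b' = b
    · subst hb'
      simpa [MarketState.pairUp] using hpb
    · simp [MarketState.pairUp, hb']
  have hoffer : ∀ s', x.offer s' ≤ (x.pairUp b s p).offer s' := fun s' => by
    by_cases hs' : s' = s
    · subst hs'
      simpa [MarketState.pairUp] using hps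
    · simp [MarketState.pairUp, hs']
  have heq : ∀ b' s', (x.pairUp b s p).paired b' s' →
      (x.pairUp b s p).bid b' = (x.pairUp b s p).offer s' := by
    rintro b' s' (⟨rfl, rfl⟩ | ⟨h1, h2, h3⟩)
    · simp [MarketState.pairUp]
    · simpa [MarketState.pairUp, h1, h2] using hx.eq_of_paired b' s' h3
  refine ⟨⟨fun b' => (hbid b').trans (hx.valid.1 b'), fun s' => (hx.valid.2.1 s').trans (hoffer s'),
    ?_, fun b' s' h => (heq b' s' h).ge⟩, ⟨fun b' => ?_, fun s' => ?_⟩, fun b' s' h => ?_, heq⟩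
  · rintro b' s' (⟨rfl, rfl⟩ | ⟨-, -, h3⟩)
    · exact hbs
    · exact hx.valid.2.2.1 b' s' h3
  · by_cases hb' : b' = b
    · subst hb'
      simpa [MarketState.pairUp] using hp
    · simpa [MarketState.pairUp, hb'] using hx.grid.1 b'
  · by_cases hs' : s' = s
    · subst hs'
      simpa [MarketState.pairUp] using hp
    · simpa [MarketState.pairUp, hs'] using hx.grid.2 s'
  · linarith [hbid b', hoffer s', hx.gap b' s' h]

theorem SellerInterested.offer_le {x : MarketState 𝓑 𝓢} {G : Market 𝓑 𝓢} {ε : ℝ} (hε : 0 < ε)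
    {s : 𝓢} {b : 𝓑} (h : x.SellerInterested G ε s b) : x.offer s ≤ x.bid b := by
  rcases h.2 with h | h <;> linarith [h.2]

theorem BuyerInterested.offer_le {x : MarketState 𝓑 𝓢} {G : Market 𝓑 𝓢} {ε : ℝ} (hε : 0 < ε)
    {b : 𝓑} {s : 𝓢} (h : x.BuyerInterested G ε b s) : x.offer s ≤ x.bid b := by
  rcases h.2 with h | h <;> linarith [h.2]

/-- On the grid, absence of interested sellers already implies both increment rules. So only the
valuation can prevent a raise, and a grid bid within `ε` below the valuation is its rounding. -/
theorem Regular.bid_eq_of_idle {x : MarketState 𝓑 𝓢} {G : Market 𝓑 𝓢} {ε : ℝ} (hε : 0 < ε)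
    (hx : x.Regular G ε) {b : 𝓑} (h : x.IdleB G ε b) : x.bid b = (G.onGrid ε).valB b := by
  obtain ⟨-, h1, h2⟩ := h
  have h3 : G.valB b < x.bid b + ε := by
    by_contra! h3
    refine h1 ⟨h3, fun s hs => ?_⟩
    have h4 : x.MatchedS s → x.bid b ≤ x.offer s := fun hm => by
      by_contra! h4
      have := add_le_of_grid_lt hε (hx.grid.2 s).1 (hx.grid.1 b).1 h4
      exact h2 ⟨s, hs, Or.inr ⟨hm, by linarith⟩⟩
    -- An unmatched seller is interested already at equality, so lack of interest is a strict
    -- inequality, which the grid improves by `ε`.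
    have h5 : ¬ x.MatchedS s → x.bid b + ε ≤ x.offer s := fun hm => by
      refine add_le_of_grid_lt hε (hx.grid.1 b).1 (hx.grid.2 s).1 ?_
      by_contra! h5
      exact h2 ⟨s, hs, Or.inl ⟨hm, h5⟩⟩
    refine ⟨?_, h5⟩
    by_cases hm : x.MatchedS s
    · linarith [h4 hm]
    · linarith [h5 hm]
  obtain ⟨k, hk⟩ := (hx.grid.1 b).1
  have h4 := hx.valid.1 b
  have h5 : ⌊G.valB b / ε⌋ = k := by
    rw [Int.floor_eq_iff, le_div_iff₀ hε, div_lt_iff₀ hε]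
    constructor <;> nlinarith
  simp [Market.onGrid, h5, hk]

theorem Regular.offer_eq_of_idle {x : MarketState 𝓑 𝓢} {G : Market 𝓑 𝓢} {ε : ℝ} (hε : 0 < ε)
    (hx : x.Regular G ε) {s : 𝓢} (h : x.IdleS G ε s) : x.offer s = (G.onGrid ε).valS s := by
  obtain ⟨-, h1, h2⟩ := h
  have h3 : x.offer s - ε < G.valS s := by
    by_contra! h3
    refine h1 ⟨h3, fun b hb => ?_⟩
    have h4 : x.MatchedB b → x.bid b ≤ x.offer s := fun hm => by
      by_contra! h4
      have := add_le_of_grid_lt hε (hx.grid.2 s).1 (hx.grid.1 b).1 h4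
      exact h2 ⟨b, hb, Or.inr ⟨hm, by linarith⟩⟩
    have h5 : ¬ x.MatchedB b → x.bid b ≤ x.offer s - ε := fun hm => by
      have := add_le_of_grid_lt hε (hx.grid.1 b).1 (hx.grid.2 s).1 (by
        by_contra! h5
        exact h2 ⟨b, hb, Or.inl ⟨hm, h5⟩⟩)
      linarith
    refine ⟨?_, h5⟩
    by_cases hm : x.MatchedB b
    · linarith [h4 hm]
    · linarith [h5 hm]
  obtain ⟨k, hk⟩ := (hx.grid.2 s).1
  have h4 := hx.valid.2.1 s
  have h5 : ⌈G.valS s / ε⌉ = k := by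
    rw [Int.ceil_eq_iff, div_le_iff₀ hε, lt_div_iff₀ hε]
    constructor <;> nlinarith
  simp [Market.onGrid, h5, hk]

/-- The only buyer who can lose his partner is the former partner of `s`. -/
theorem matchedB_of_not_matchedB_pairUp {x : MarketState 𝓑 𝓢} {b b' : 𝓑} {s : 𝓢} {p : ℝ}
    (h : ¬ (x.pairUp b s p).MatchedB b') : b' ≠ b ∧ ∀ s', x.paired b' s' → s' = s := by
  have hb : b' ≠ b := fun e => h ⟨s, Or.inl ⟨e, rfl⟩⟩
  refine ⟨hb, fun s' hp => ?_⟩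
  by_contra hs
  exact h ⟨s', Or.inr ⟨hb, hs, hp⟩⟩

theorem matchedS_of_not_matchedS_pairUp {x : MarketState 𝓑 𝓢} {b : 𝓑} {s s' : 𝓢} {p : ℝ}
    (h : ¬ (x.pairUp b s p).MatchedS s') : s' ≠ s ∧ ∀ b', x.paired b' s' → b' = b := by
  have hs : s' ≠ s := fun e => h ⟨b, Or.inl ⟨rfl, e⟩⟩
  refine ⟨hs, fun b' hp => ?_⟩
  by_contra hb
  exact h ⟨b', Or.inr ⟨hb, hs, hp⟩⟩

/-! ### The price level. -/

/-- The sum of all prices, in units of `ε`. -/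
noncomputable def level [Fintype 𝓑] [Fintype 𝓢] (x : MarketState 𝓑 𝓢) (ε : ℝ) : ℝ :=
  (∑ b, x.bid b + ∑ s, x.offer s) / ε

theorem sum_update_eq {ι : Type*} [Fintype ι] [DecidableEq ι] (f : ι → ℝ) (i : ι) (a : ℝ) :
    ∑ j, Function.update f i a j = ∑ j, f j + (a - f i) := by
  rw [Finset.sum_update_of_mem (Finset.mem_univ i),
    ← Finset.sum_sdiff (Finset.subset_univ {i}), Finset.sum_singleton]
  ring

theorem level_raiseBid [Fintype 𝓑] [Fintype 𝓢] (x : MarketState 𝓑 𝓢) {ε : ℝ} (hε : 0 < ε)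
    (b : 𝓑) : (x.raiseBid ε b).level ε = x.level ε + 1 := by
  simp only [level, raiseBid, sum_update_eq]
  field_simp
  ring

theorem level_lowerOffer [Fintype 𝓑] [Fintype 𝓢] (x : MarketState 𝓑 𝓢) {ε : ℝ} (hε : 0 < ε)
    (s : 𝓢) : (x.lowerOffer ε s).level ε = x.level ε - 1 := by
  simp only [level, lowerOffer, sum_update_eq]
  field_simp
  ring

theorem level_pairUp [Fintype 𝓑] [Fintype 𝓢] (x : MarketState 𝓑 𝓢) (ε : ℝ)
    (b : 𝓑) (s : 𝓢) (p : ℝ) :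
    (x.pairUp b s p).level ε = x.level ε + ((p - x.bid b) + (p - x.offer s)) / ε := by
  simp only [level, pairUp, sum_update_eq]
  ring

theorem Regular.level_mem [Fintype 𝓑] [Fintype 𝓢] {x : MarketState 𝓑 𝓢} {G : Market 𝓑 𝓢} {ε : ℝ}
    (hε : 0 < ε) (hx : x.Regular G ε) :
    x.level ε ∈ Set.Icc 0 (((Fintype.card 𝓑 + Fintype.card 𝓢 : ℕ) : ℝ) * ⌈1 / ε⌉) := by
  have h1 : 0 ≤ ∑ b, x.bid b := Finset.sum_nonneg fun b _ => (hx.grid.1 b).2.1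
  have h2 : 0 ≤ ∑ s, x.offer s := Finset.sum_nonneg fun s _ => (hx.grid.2 s).2.1
  have h3 : ∑ b, x.bid b ≤ Fintype.card 𝓑 * (⌈1 / ε⌉ * ε) := by
    simpa using Finset.sum_le_card_nsmul Finset.univ x.bid _ fun b _ => (hx.grid.1 b).2.2
  have h4 : ∑ s, x.offer s ≤ Fintype.card 𝓢 * (⌈1 / ε⌉ * ε) := by
    simpa using Finset.sum_le_card_nsmul Finset.univ x.offer _ fun s _ => (hx.grid.2 s).2.2
  refine ⟨by unfold level; positivity, ?_⟩
  rw [level, div_le_iff₀ hε]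
  push_cast
  linarith

end MarketState

/-! ### Invariants of configurations. -/

namespace Config

/-- The properties of configurations that every move of an active player preserves. -/
structure Regular (c : Config 𝓑 𝓢) (G : Market 𝓑 𝓢) (ε : ℝ) : Prop where
  state : c.state.Regular G ε
  labeled : c.Labeled G ε
  bid_eq : ∀ b ∈ c.inactiveB, c.state.bid b = (G.onGrid ε).valB b
  offer_eq : ∀ s ∈ c.inactiveS, c.state.offer s = (G.onGrid ε).valS s

theorem regular_start {G : Market 𝓑 𝓢} {ε : ℝ} (hε : 0 < ε) {x : MarketState 𝓑 𝓢}
    (h : x.IsValidStart G ε) : (start G ε x).Regular G ε where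
  state := h.regular hε
  labeled := labeled_start G ε x
  bid_eq _ hb := (h.regular hε).bid_eq_of_idle hε hb
  offer_eq _ hs := (h.regular hε).offer_eq_of_idle hε hs

/-- Prices need to be preserved only for inactive players who remain unmatched, since matching
removes the label. -/
theorem Regular.next {c : Config 𝓑 𝓢} {G : Market 𝓑 𝓢} {ε : ℝ} (hε : 0 < ε) (hc : c.Regular G ε)
    {y : MarketState 𝓑 𝓢} (hy : y.Regular G ε)
    (hB : ∀ b ∈ c.inactiveB, ¬ y.MatchedB b → y.bid b = c.state.bid b)
    (hS : ∀ s ∈ c.inactiveS, ¬ y.MatchedS s → y.offer s = c.state.offer s) :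
    (c.next G ε y).Regular G ε where
  state := hy
  labeled := c.labeled_next G ε y
  bid_eq := by
    rintro b ⟨h1, h2 | h2⟩
    · exact (hB b h2 h1).trans (hc.bid_eq b h2)
    · exact hy.bid_eq_of_idle hε h2
  offer_eq := by
    rintro s ⟨h1, h2 | h2⟩
    · exact (hS s h2 h1).trans (hc.offer_eq s h2)
    · exact hy.offer_eq_of_idle hε h2

theorem Regular.next_pairUp {c : Config 𝓑 𝓢} {G : Market 𝓑 𝓢} {ε : ℝ} (hε : 0 < ε)
    (hc : c.Regular G ε) {b : 𝓑} {s : 𝓢} {p : ℝ}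
    (hy : (c.state.pairUp b s p).Regular G ε) :
    (c.next G ε (c.state.pairUp b s p)).Regular G ε := by
  refine hc.next hε hy (fun b' _ h => ?_) (fun s' _ h => ?_)
  · simp [MarketState.pairUp, (MarketState.matchedB_of_not_matchedB_pairUp h).1]
  · simp [MarketState.pairUp, (MarketState.matchedS_of_not_matchedS_pairUp h).1]

/-! ### Counting active players. -/

open Classical in
noncomputable def activeB [Fintype 𝓑] (c : Config 𝓑 𝓢) : Finset 𝓑 :=
  Finset.univ.filter fun b => c.IsActive (Sum.inl b)

open Classical in
noncomputable def activeS [Fintype 𝓢] (c : Config 𝓑 𝓢) : Finset 𝓢 :=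
  Finset.univ.filter fun s => c.IsActive (Sum.inr s)

theorem mem_activeB [Fintype 𝓑] {c : Config 𝓑 𝓢} {b : 𝓑} :
    b ∈ c.activeB ↔ ¬ c.state.MatchedB b ∧ b ∉ c.inactiveB := by
  classical
  rw [activeB, Finset.mem_filter]
  exact and_iff_right (Finset.mem_univ b)

theorem mem_activeS [Fintype 𝓢] {c : Config 𝓑 𝓢} {s : 𝓢} :
    s ∈ c.activeS ↔ ¬ c.state.MatchedS s ∧ s ∉ c.inactiveS := by
  classical
  rw [activeS, Finset.mem_filter]
  exact and_iff_right (Finset.mem_univ s)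

theorem activePlayers_eq [Fintype 𝓑] [Fintype 𝓢] (c : Config 𝓑 𝓢) :
    c.activePlayers = c.activeB.disjSum c.activeS := by
  ext (b | s) <;> simp [activePlayers, activeB, activeS]

/-- An inactive player who stays unmatched keeps his label; this is what keeps the number of active
players from growing. -/
theorem of_mem_activeB_next [Fintype 𝓑] {c : Config 𝓑 𝓢} {G : Market 𝓑 𝓢} {ε : ℝ} {y : MarketState 𝓑 𝓢}
    {b : 𝓑} (h : b ∈ (c.next G ε y).activeB) : ¬ y.MatchedB b ∧ b ∉ c.inactiveB := by
  rw [mem_activeB] at h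
  exact ⟨h.1, fun hb => h.2 ⟨h.1, Or.inl hb⟩⟩

theorem of_mem_activeS_next [Fintype 𝓢] {c : Config 𝓑 𝓢} {G : Market 𝓑 𝓢} {ε : ℝ} {y : MarketState 𝓑 𝓢}
    {s : 𝓢} (h : s ∈ (c.next G ε y).activeS) : ¬ y.MatchedS s ∧ s ∉ c.inactiveS := by
  rw [mem_activeS] at h
  exact ⟨h.1, fun hs => h.2 ⟨h.1, Or.inl hs⟩⟩

theorem card_activeB_next_le [Fintype 𝓑] {c : Config 𝓑 𝓢} (G : Market 𝓑 𝓢) (ε : ℝ) {y : MarketState 𝓑 𝓢}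
    (hy : y.paired = c.state.paired) : (c.next G ε y).activeB.card ≤ c.activeB.card := by
  refine Finset.card_le_card fun b hb => ?_
  have h := of_mem_activeB_next hb
  rw [MarketState.MatchedB, hy] at h
  exact mem_activeB.2 h

theorem card_activeS_next_le [Fintype 𝓢] {c : Config 𝓑 𝓢} (G : Market 𝓑 𝓢) (ε : ℝ) {y : MarketState 𝓑 𝓢}
    (hy : y.paired = c.state.paired) : (c.next G ε y).activeS.card ≤ c.activeS.card := by
  refine Finset.card_le_card fun s hs => ?_
  have h := of_mem_activeS_next hs
  rw [MarketState.MatchedS, hy] at h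
  exact mem_activeS.2 h

-- An unmatched `s` has no partner to displace, so no buyer becomes active and `b` leaves.
open Classical in
theorem activeB_next_pairUp_subset [Fintype 𝓑] {c : Config 𝓑 𝓢} (G : Market 𝓑 𝓢) (ε : ℝ) (b : 𝓑) {s : 𝓢}
    (p : ℝ) (hs : ¬ c.state.MatchedS s) :
    (c.next G ε (c.state.pairUp b s p)).activeB ⊆ c.activeB.erase b := by
  intro b' hb'
  have h := of_mem_activeB_next hb'
  have h1 := MarketState.matchedB_of_not_matchedB_pairUp h.1
  refine Finset.mem_erase.2 ⟨h1.1, mem_activeB.2 ⟨?_, h.2⟩⟩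
  rintro ⟨s', hs'⟩
  exact hs ⟨b', h1.2 s' hs' ▸ hs'⟩

open Classical in
theorem activeS_next_pairUp_subset [Fintype 𝓢] {c : Config 𝓑 𝓢} (G : Market 𝓑 𝓢) (ε : ℝ) {b : 𝓑} (s : 𝓢)
    (p : ℝ) (hb : ¬ c.state.MatchedB b) :
    (c.next G ε (c.state.pairUp b s p)).activeS ⊆ c.activeS.erase s := by
  intro s' hs'
  have h := of_mem_activeS_next hs'
  have h1 := MarketState.matchedS_of_not_matchedS_pairUp h.1
  refine Finset.mem_erase.2 ⟨h1.1, mem_activeS.2 ⟨?_, h.2⟩⟩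
  rintro ⟨b', hb'⟩
  exact hb ⟨s', h1.2 b' hb' ▸ hb'⟩

/-- The displaced partner `b₀` of `s` may become active, but `b` ceases to be. -/
theorem card_activeB_next_pairUp_le [Fintype 𝓑] {c : Config 𝓑 𝓢} (G : Market 𝓑 𝓢) (ε : ℝ) {b : 𝓑} {s : 𝓢}
    (p : ℝ) (hb : b ∈ c.activeB) (hs : c.state.MatchedS s) :
    (c.next G ε (c.state.pairUp b s p)).activeB.card ≤ c.activeB.card := by
  classical
  obtain ⟨b₀, hb₀⟩ := hs
  have h : (c.next G ε (c.state.pairUp b s p)).activeB ⊆ insert b₀ (c.activeB.erase b) := by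
    intro b' hb'
    have h := of_mem_activeB_next hb'
    have h1 := MarketState.matchedB_of_not_matchedB_pairUp h.1
    by_cases hm : c.state.MatchedB b'
    · obtain ⟨s', hs'⟩ := hm
      have := h1.2 s' hs'
      subst this
      exact Finset.mem_insert.2 (Or.inl (c.state.buyer_unique _ _ _ hs' hb₀))
    · exact Finset.mem_insert_of_mem (Finset.mem_erase.2 ⟨h1.1, mem_activeB.2 ⟨hm, h.2⟩⟩)
  have h1 := (Finset.card_le_card h).trans (Finset.card_insert_le _ _)
  rwa [Finset.card_erase_add_one hb] at h1

theorem card_activeS_next_pairUp_le [Fintype 𝓢] {c : Config 𝓑 𝓢} (G : Market 𝓑 𝓢) (ε : ℝ) {b : 𝓑} {s : 𝓢}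
    (p : ℝ) (hs : s ∈ c.activeS) (hb : c.state.MatchedB b) :
    (c.next G ε (c.state.pairUp b s p)).activeS.card ≤ c.activeS.card := by
  classical
  obtain ⟨s₀, hs₀⟩ := hb
  have h : (c.next G ε (c.state.pairUp b s p)).activeS ⊆ insert s₀ (c.activeS.erase s) := by
    intro s' hs'
    have h := of_mem_activeS_next hs'
    have h1 := MarketState.matchedS_of_not_matchedS_pairUp h.1
    by_cases hm : c.state.MatchedS s'
    · obtain ⟨b', hb'⟩ := hm
      have := h1.2 b' hb'
      subst this
      exact Finset.mem_insert.2 (Or.inl (c.state.seller_unique _ _ _ hb' hs₀))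
    · exact Finset.mem_insert_of_mem (Finset.mem_erase.2 ⟨h1.1, mem_activeS.2 ⟨hm, h.2⟩⟩)
  have h1 := (Finset.card_le_card h).trans (Finset.card_insert_le _ _)
  rwa [Finset.card_erase_add_one hs] at h1

variable [Fintype 𝓑] [Fintype 𝓢]

/-- The direction in which a recognized player moves prices: buyers up, sellers down. -/
def direction : 𝓑 ⊕ 𝓢 → ℝ
  | Sum.inl _ => 1
  | Sum.inr _ => -1

/-- There are three cases. A raise adds `ε` to one price. Taking over a matched seller adds `ε` to
her offer and exchanges `b` for her old partner. Matching an unmatched seller removes `b` from the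
active players, and then the change of level is irrelevant. -/
theorem Regular.move_buyer {c c' : Config 𝓑 𝓢} {G : Market 𝓑 𝓢} {ε : ℝ} (hε : 0 < ε)
    (hG : G.UnitValuations) (hc : c.Regular G ε) {b : 𝓑} (hb : b ∈ c.activeB)
    (h : c.Move G ε (Sum.inl b) c') :
    c'.Regular G ε ∧ c'.activeB.card ≤ c.activeB.card ∧ c'.activeS.card ≤ c.activeS.card ∧
      (c'.activeB.card + c'.activeS.card < c.activeB.card + c.activeS.card ∨
        c'.state.level ε = c.state.level ε + 1) := by
  obtain ⟨hbm, hbi⟩ := mem_activeB.1 hb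
  obtain ⟨y, ⟨hr, rfl⟩ | ⟨s, hs, -, rfl⟩, rfl⟩ := h
  · refine ⟨hc.next hε (hc.state.raiseBid hε hG hbm hr) (fun b' hb' _ => ?_) (fun _ _ _ => rfl),
      card_activeB_next_le G ε rfl, card_activeS_next_le G ε rfl,
      Or.inr (c.state.level_raiseBid hε b)⟩
    have : b' ≠ b := fun e => hbi (e ▸ hb')
    simp [MarketState.raiseBid, this]
  · have hle := hs.offer_le hε
    have hreg := hc.next_pairUp hε (hc.state.pairUp hs.1 (hc.state.grid.1 b) le_rfl hle)
    classical
    have hS := Finset.card_le_card (activeS_next_pairUp_subset G ε s (c.state.bid b) hbm)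
    have hS' := hS.trans (Finset.card_erase_le)
    by_cases hm : c.state.MatchedS s
    · refine ⟨hreg, card_activeB_next_pairUp_le G ε _ hb hm, hS', Or.inr ?_⟩
      -- The gap invariant bounds the difference above by `ε`, the interest of a matched seller
      -- bounds it below.
      have h1 : c.state.bid b - c.state.offer s = ε := by
        refine le_antisymm (hc.state.gap b s hs.1) ?_
        rcases hs.2 with h2 | h2
        · exact absurd hm h2.1
        · exact h2.2
      change (c.state.pairUp b s (c.state.bid b)).level ε = _
      rw [MarketState.level_pairUp, h1, sub_self, zero_add, div_self hε.ne']
    · have hB := Finset.card_le_card (activeB_next_pairUp_subset G ε b (c.state.bid b) hm)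
      have hlt := Finset.card_erase_lt_of_mem hb
      exact ⟨hreg, by omega, hS', Or.inl (by omega)⟩

theorem Regular.move_seller {c c' : Config 𝓑 𝓢} {G : Market 𝓑 𝓢} {ε : ℝ} (hε : 0 < ε)
    (hG : G.UnitValuations) (hc : c.Regular G ε) {s : 𝓢} (hs : s ∈ c.activeS)
    (h : c.Move G ε (Sum.inr s) c') :
    c'.Regular G ε ∧ c'.activeB.card ≤ c.activeB.card ∧ c'.activeS.card ≤ c.activeS.card ∧
      (c'.activeB.card + c'.activeS.card < c.activeB.card + c.activeS.card ∨
        c'.state.level ε = c.state.level ε - 1) := by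
  obtain ⟨hsm, hsi⟩ := mem_activeS.1 hs
  obtain ⟨y, ⟨hr, rfl⟩ | ⟨b, hb, -, rfl⟩, rfl⟩ := h
  · refine ⟨hc.next hε (hc.state.lowerOffer hε hG hsm hr) (fun _ _ _ => rfl) (fun s' hs' _ => ?_),
      card_activeB_next_le G ε rfl, card_activeS_next_le G ε rfl,
      Or.inr (c.state.level_lowerOffer hε s)⟩
    have : s' ≠ s := fun e => hsi (e ▸ hs')
    simp [MarketState.lowerOffer, this]
  · have hle := hb.offer_le hε
    have hreg := hc.next_pairUp hε (hc.state.pairUp hb.1 (hc.state.grid.2 s) hle le_rfl)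
    classical
    have hB := Finset.card_le_card (activeB_next_pairUp_subset G ε b (c.state.offer s) hsm)
    have hB' := hB.trans (Finset.card_erase_le)
    by_cases hm : c.state.MatchedB b
    · refine ⟨hreg, hB', card_activeS_next_pairUp_le G ε _ hs hm, Or.inr ?_⟩
      have h1 : c.state.bid b = c.state.offer s + ε := by
        have h3 := hc.state.gap b s hb.1
        rcases hb.2 with h2 | h2
        · exact absurd hm h2.1
        · linarith [h2.2]
      change (c.state.pairUp b s (c.state.offer s)).level ε = _
      rw [MarketState.level_pairUp, h1]
      field_simp
      ring
    · have hS := Finset.card_le_card (activeS_next_pairUp_subset G ε s (c.state.offer s) hm)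
      have hlt := Finset.card_erase_lt_of_mem hs
      exact ⟨hreg, hB', by omega, Or.inl (by omega)⟩

theorem Regular.move {c c' : Config 𝓑 𝓢} {G : Market 𝓑 𝓢} {ε : ℝ} (hε : 0 < ε)
    (hG : G.UnitValuations) (hc : c.Regular G ε) {z : 𝓑 ⊕ 𝓢} (hz : z ∈ c.activePlayers)
    (h : c.Move G ε z c') :
    c'.Regular G ε ∧ c'.activeB.card ≤ c.activeB.card ∧ c'.activeS.card ≤ c.activeS.card ∧
      (c'.activeB.card + c'.activeS.card < c.activeB.card + c.activeS.card ∨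
        c'.state.level ε = c.state.level ε + direction z) := by
  rw [activePlayers_eq] at hz
  rcases z with b | s
  · exact hc.move_buyer hε hG (Finset.inl_mem_disjSum.1 hz) h
  · exact hc.move_seller hε hG (Finset.inr_mem_disjSum.1 hz) h

theorem Regular.converged {c : Config 𝓑 𝓢} {G : Market 𝓑 𝓢} {ε : ℝ} (hc : c.Regular G ε)
    (h : c.activePlayers = ∅) : c ∈ Converged G ε := by
  have hB : ∀ b, ¬ c.state.MatchedB b → b ∈ c.inactiveB := fun b hb => by
    by_contra hi
    have : Sum.inl b ∈ c.activePlayers := by simp [activePlayers, IsActive, hb, hi]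
    simp [h] at this
  have hS : ∀ s, ¬ c.state.MatchedS s → s ∈ c.inactiveS := fun s hs => by
    by_contra hi
    have : Sum.inr s ∈ c.activePlayers := by simp [activePlayers, IsActive, hs, hi]
    simp [h] at this
  exact ⟨h, hc.state.valid, hc.state.gap, ⟨fun b hb => hc.bid_eq b (hB b hb),
    fun s hs => hc.offer_eq s (hS s hs)⟩, hc.state.eq_of_paired⟩

end Config

/-! ### A Lyapunov function for the price walk. -/

/-- A Lyapunov function of the random walk on `[0, M]` that moves up with probability
`p / (p + q)` and down with probability `q / (p + q)`. -/
noncomputable def walkPotential (M : ℝ) (p q : ℕ) (x : ℝ) : ℝ :=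
  1 - (if q ≤ p then x else M - x) ^ 2 / (M + 1) ^ 2

/-- The drift estimate evaluates the function one step beyond `[0, M]`; the denominator `(M + 1) ^
2` keeps the values in `[0, 1]` there too. -/
theorem walkPotential_mem {M : ℝ} (hM : 0 ≤ M) (p q : ℕ) {x : ℝ} (hx : x ∈ Set.Icc (-1) (M + 1)) :
    walkPotential M p q x ∈ Set.Icc 0 1 := by
  have h : (if q ≤ p then x else M - x) ^ 2 ≤ (M + 1) ^ 2 := by
    obtain ⟨h1, h2⟩ := hx
    apply sq_le_sq'
    · split_ifs <;> linarith
    · split_ifs <;> linarith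
  have h2 : 0 < (M + 1) ^ 2 := by positivity
  have h3 := (div_le_one h2).2 h
  have h4 : 0 ≤ (if q ≤ p then x else M - x) ^ 2 / (M + 1) ^ 2 := by positivity
  exact ⟨by unfold walkPotential; linarith, by unfold walkPotential; linarith⟩

/-- One has `p(x+1)² + q(x-1)² = (p+q)(x²+1) + 2(p-q)x`, and the last term is nonnegative if `q ≤
p`. The other case is the reflection `x ↦ M - x`. -/
theorem walkPotential_drift {M : ℝ} (hM : 0 ≤ M) (p q : ℕ) {x : ℝ} (hx : x ∈ Set.Icc 0 M) :
    p * walkPotential M p q (x + 1) + q * walkPotential M p q (x - 1) ≤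
      (p + q) * (walkPotential M p q x - 1 / (M + 1) ^ 2) := by
  have h2 : 0 < (M + 1) ^ 2 := by positivity
  obtain ⟨hx0, hxM⟩ := hx
  have key : ∀ a b c : ℝ, (p + q) * (c + 1) ≤ p * a + q * b →
      p * (1 - a / (M + 1) ^ 2) + q * (1 - b / (M + 1) ^ 2) ≤
        (p + q) * (1 - c / (M + 1) ^ 2 - 1 / (M + 1) ^ 2) := by
    intro a b c h
    have := (div_le_div_iff_of_pos_right h2).2 h
    have e1 : (p * a + q * b) / (M + 1) ^ 2 = p * (a / (M + 1) ^ 2) + q * (b / (M + 1) ^ 2) := by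
      ring
    have e2 : ((p + q) * (c + 1)) / (M + 1) ^ 2 =
        (p + q) * (c / (M + 1) ^ 2 + 1 / (M + 1) ^ 2) := by ring
    rw [e1, e2] at this
    linarith
  unfold walkPotential
  apply key
  by_cases h : q ≤ p
  · simp only [h, if_true]
    have h' : (q : ℝ) ≤ p := by exact_mod_cast h
    nlinarith [mul_nonneg hx0 (sub_nonneg.2 h')]
  · simp only [h, if_false]
    have h' : (p : ℝ) ≤ q := by exact_mod_cast (not_le.1 h).le
    nlinarith [mul_nonneg (sub_nonneg.2 hxM) (sub_nonneg.2 h')]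

/-! ### The potential of a configuration and its drift. -/

namespace Config

variable [Fintype 𝓑] [Fintype 𝓢]

/-- The number of active players plus a term that measures how far the current phase of the
price walk has progressed. -/
noncomputable def potential (M ε : ℝ) (c : Config 𝓑 𝓢) : ℝ :=
  ((c.activeB.card + c.activeS.card : ℕ) : ℝ) +
    walkPotential M c.activeB.card c.activeS.card (c.state.level ε)

/-- The largest possible value of the price level. -/
noncomputable def maxLevel (𝓑 : Type u) (𝓢 : Type v) [Fintype 𝓑] [Fintype 𝓢] (ε : ℝ) : ℝ :=
  ((Fintype.card 𝓑 + Fintype.card 𝓢 : ℕ) : ℝ) * ⌈1 / ε⌉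

theorem maxLevel_nonneg {ε : ℝ} (hε : 0 < ε) : 0 ≤ maxLevel 𝓑 𝓢 ε := by
  have : 0 ≤ 1 / ε := by positivity
  have : (0 : ℝ) ≤ ⌈1 / ε⌉ := by exact_mod_cast Int.ceil_nonneg this
  unfold maxLevel
  positivity

theorem Regular.level_mem {c : Config 𝓑 𝓢} {G : Market 𝓑 𝓢} {ε : ℝ} (hε : 0 < ε)
    (hc : c.Regular G ε) : c.state.level ε ∈ Set.Icc 0 (maxLevel 𝓑 𝓢 ε) :=
  hc.state.level_mem hε

theorem Regular.walkPotential_mem {c : Config 𝓑 𝓢} {G : Market 𝓑 𝓢} {ε : ℝ} (hε : 0 < ε)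
    (hc : c.Regular G ε) (p q : ℕ) :
    walkPotential (maxLevel 𝓑 𝓢 ε) p q (c.state.level ε) ∈ Set.Icc 0 1 := by
  have h := hc.level_mem hε
  exact DoubleAuction.walkPotential_mem (maxLevel_nonneg hε) p q
    ⟨by linarith [h.1], by linarith [h.2]⟩

theorem Regular.potential_le {c : Config 𝓑 𝓢} {G : Market 𝓑 𝓢} {ε : ℝ} (hε : 0 < ε)
    (hc : c.Regular G ε) : c.potential (maxLevel 𝓑 𝓢 ε) ε ≤
      ((Fintype.card 𝓑 + Fintype.card 𝓢 : ℕ) : ℝ) + 1 := by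
  have h1 : ((c.activeB.card + c.activeS.card : ℕ) : ℝ) ≤
      ((Fintype.card 𝓑 + Fintype.card 𝓢 : ℕ) : ℝ) := by
    exact_mod_cast Nat.add_le_add (Finset.card_le_univ _) (Finset.card_le_univ _)
  have h2 := (hc.walkPotential_mem hε c.activeB.card c.activeS.card).2
  unfold potential
  linarith

theorem card_activePlayers (c : Config 𝓑 𝓢) :
    c.activePlayers.card = c.activeB.card + c.activeS.card := by
  rw [activePlayers_eq, Finset.card_disjSum]

theorem Regular.one_le_potential {c : Config 𝓑 𝓢} {G : Market 𝓑 𝓢} {ε : ℝ} (hε : 0 < ε)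
    (hc : c.Regular G ε) (h : c.activePlayers.Nonempty) :
    1 ≤ c.potential (maxLevel 𝓑 𝓢 ε) ε := by
  have h1 : (1 : ℝ) ≤ ((c.activeB.card + c.activeS.card : ℕ) : ℝ) := by
    rw [← card_activePlayers]
    exact_mod_cast h.card_pos
  have h2 := (hc.walkPotential_mem hε c.activeB.card c.activeS.card).1
  unfold potential
  linarith

/-- An upper bound for the potential after player `z` has moved. -/
noncomputable def potentialBound (M ε : ℝ) (c : Config 𝓑 𝓢) (z : 𝓑 ⊕ 𝓢) : ℝ :=
  ((c.activeB.card + c.activeS.card : ℕ) : ℝ) +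
    walkPotential M c.activeB.card c.activeS.card (c.state.level ε + direction z)

theorem Regular.walkPotential_direction_mem {c : Config 𝓑 𝓢} {G : Market 𝓑 𝓢} {ε : ℝ}
    (hε : 0 < ε) (hc : c.Regular G ε) (p q : ℕ) (z : 𝓑 ⊕ 𝓢) :
    walkPotential (maxLevel 𝓑 𝓢 ε) p q (c.state.level ε + direction z) ∈ Set.Icc 0 1 := by
  have h := hc.level_mem hε
  apply DoubleAuction.walkPotential_mem (maxLevel_nonneg hε)
  rcases z with b | s
  · exact ⟨by simp only [direction]; linarith [h.1], by simp only [direction]; linarith [h.2]⟩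
  · exact ⟨by simp only [direction]; linarith [h.1], by simp only [direction]; linarith [h.2]⟩

/-- If an active player is lost, the gain of 1 covers any change of the walk term, including a
change of its reference end. Otherwise the level moves by `direction z`. -/
theorem Regular.potential_move_le {c c' : Config 𝓑 𝓢} {G : Market 𝓑 𝓢} {ε : ℝ} (hε : 0 < ε)
    (hG : G.UnitValuations) (hc : c.Regular G ε) {z : 𝓑 ⊕ 𝓢} (hz : z ∈ c.activePlayers)
    (h : c.Move G ε z c') :
    c'.potential (maxLevel 𝓑 𝓢 ε) ε ≤ c.potentialBound (maxLevel 𝓑 𝓢 ε) ε z := by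
  obtain ⟨hc', hB, hS, hlt⟩ := hc.move hε hG hz h
  by_cases hlt' : c'.activeB.card + c'.activeS.card < c.activeB.card + c.activeS.card
  · have h1 : ((c'.activeB.card + c'.activeS.card : ℕ) : ℝ) + 1 ≤
        ((c.activeB.card + c.activeS.card : ℕ) : ℝ) := by exact_mod_cast hlt'
    have h2 := (hc'.walkPotential_mem hε c'.activeB.card c'.activeS.card).2
    have h3 := (hc.walkPotential_direction_mem hε c.activeB.card c.activeS.card z).1
    unfold potential potentialBound
    linarith
  -- Neither count grows and their sum does not fall, so both are unchanged and the same Lyapunov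
  -- function applies.
  · have h1 : c'.activeB.card = c.activeB.card := by omega
    have h2 : c'.activeS.card = c.activeS.card := by omega
    rw [potential, potentialBound, h1, h2, hlt.resolve_left hlt']

theorem Regular.sum_potentialBound_le {c : Config 𝓑 𝓢} {G : Market 𝓑 𝓢} {ε : ℝ} (hε : 0 < ε)
    (hc : c.Regular G ε) :
    ∑ z ∈ c.activePlayers, c.potentialBound (maxLevel 𝓑 𝓢 ε) ε z ≤
      c.activePlayers.card *
        (c.potential (maxLevel 𝓑 𝓢 ε) ε - 1 / (maxLevel 𝓑 𝓢 ε + 1) ^ 2) := by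
  rw [card_activePlayers, activePlayers_eq, Finset.sum_disjSum]
  simp only [potentialBound, direction, Finset.sum_const, nsmul_eq_mul, potential]
  have := walkPotential_drift (maxLevel_nonneg hε) c.activeB.card c.activeS.card
    (hc.level_mem hε)
  push_cast
  rw [← sub_eq_add_neg]
  linarith

end Config

/-! ### Expectations of nonnegative functions and a Markov inequality. -/

section Expectation

variable {α β : Type*}

/-- The expectation of a nonnegative function. -/
noncomputable def expect (p : PMF α) (f : α → ℝ≥0∞) : ℝ≥0∞ := ∑' x, p x * f x

theorem expect_bind (p : PMF α) (κ : α → PMF β) (f : β → ℝ≥0∞) :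
    expect (p.bind κ) f = expect p fun x => expect (κ x) f := by
  simp only [expect, PMF.bind_apply, ← ENNReal.tsum_mul_right, ← ENNReal.tsum_mul_left]
  rw [ENNReal.tsum_comm]
  simp only [mul_assoc]

theorem expect_pure (a : α) (f : α → ℝ≥0∞) : expect (PMF.pure a) f = f a := by
  rw [expect, tsum_eq_single a fun x hx => by simp [PMF.pure_apply, hx]]
  simp

theorem expect_map (p : PMF α) (g : α → β) (f : β → ℝ≥0∞) :
    expect (p.map g) f = expect p (f ∘ g) := by
  rw [← PMF.bind_pure_comp, expect_bind]
  simp only [Function.comp_apply, expect_pure]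
  rfl

theorem expect_mono {p : PMF α} {f g : α → ℝ≥0∞} (h : ∀ x ∈ p.support, f x ≤ g x) :
    expect p f ≤ expect p g := by
  refine ENNReal.tsum_le_tsum fun x => ?_
  by_cases hx : p x = 0
  · simp [hx]
  · gcongr
    exact h x ((PMF.mem_support_iff p x).2 hx)

theorem expect_const (p : PMF α) (a : ℝ≥0∞) : expect p (fun _ => a) = a := by
  rw [expect, ENNReal.tsum_mul_right, p.tsum_coe, one_mul]

theorem expect_const_mul (p : PMF α) (a : ℝ≥0∞) (f : α → ℝ≥0∞) :
    expect p (fun x => a * f x) = a * expect p f := by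
  simp only [expect, ← ENNReal.tsum_mul_left]
  exact tsum_congr fun x => by ring

theorem expect_uniformOfFinset {s : Finset α} (hs : s.Nonempty) (f : α → ℝ≥0∞) :
    expect (PMF.uniformOfFinset s hs) f = (s.card : ℝ≥0∞)⁻¹ * ∑ x ∈ s, f x := by
  rw [expect, tsum_eq_sum (s := s) fun x hx => by simp [hx], Finset.mul_sum]
  exact Finset.sum_congr rfl fun x hx => by simp [hx]

/-- If every outcome outside `s` has `f ≥ 1`, then `s` has probability at least `1 - E f`. -/
theorem one_le_toOuterMeasure_add_expect (p : PMF α) (s : Set α) (f : α → ℝ≥0∞)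
    (h : ∀ x ∈ p.support, x ∉ s → 1 ≤ f x) : 1 ≤ p.toOuterMeasure s + expect p f := by
  rw [← p.tsum_coe, PMF.toOuterMeasure_apply, expect, ← ENNReal.tsum_add]
  refine ENNReal.tsum_le_tsum fun x => ?_
  by_cases hx : x ∈ s
  · simp [hx]
  · by_cases hp : p x = 0
    · simp [hp]
    · have := mul_le_mul_right (h x ((PMF.mem_support_iff p x).2 hp) hx) (p x)
      simpa [hx] using this

end Expectation

/-! ### Geometric decay of the potential along a run. -/

section Run

variable [Fintype 𝓑] [Fintype 𝓢]

theorem regular_of_mem_support_runLaw {σ : Behaviour 𝓑 𝓢} {G : Market 𝓑 𝓢} {ε : ℝ} (hε : 0 < ε)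
    (hG : G.UnitValuations) (hσ : σ.Obeys G ε) {c₀ : Config 𝓑 𝓢} (h₀ : c₀.Regular G ε) (t : ℕ) :
    ∀ hc ∈ (runLaw σ c₀ t).support, hc.2.Regular G ε := by
  induction t with
  | zero =>
    intro hc h
    rw [runLaw, PMF.support_pure, Set.mem_singleton_iff] at h
    rwa [h]
  | succ t ih =>
    intro hc' h
    rw [runLaw, PMF.mem_support_bind_iff] at h
    obtain ⟨hc, h1, h2⟩ := h
    have hreg := ih hc h1
    split_ifs at h2 with hne
    · rw [PMF.mem_support_bind_iff] at h2
      obtain ⟨z, hz, h3⟩ := h2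
      rw [PMF.mem_support_map_iff] at h3
      obtain ⟨c', h4, rfl⟩ := h3
      rw [PMF.mem_support_uniformOfFinset_iff] at hz
      refine (hreg.move hε hG hz (hσ hc.1 hc.2 z hreg.labeled ?_ c' h4)).1
      simpa [Config.activePlayers] using hz
    · rw [PMF.support_pure, Set.mem_singleton_iff] at h2
      rwa [h2]

open Classical in
/-- The potential of configurations that have not come to rest yet. -/
noncomputable def livePotential (ε : ℝ) (c : Config 𝓑 𝓢) : ℝ≥0∞ :=
  if c.activePlayers.Nonempty then ENNReal.ofReal (c.potential (Config.maxLevel 𝓑 𝓢 ε) ε) else 0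

theorem livePotential_le (ε : ℝ) (c : Config 𝓑 𝓢) :
    livePotential ε c ≤ ENNReal.ofReal (c.potential (Config.maxLevel 𝓑 𝓢 ε) ε) := by
  unfold livePotential
  split_ifs
  · exact le_rfl
  · exact zero_le

/-- The time scale on which the potential decays. -/
noncomputable def decayTime (𝓑 : Type u) (𝓢 : Type v) [Fintype 𝓑] [Fintype 𝓢] (ε : ℝ) : ℝ :=
  (((Fintype.card 𝓑 + Fintype.card 𝓢 : ℕ) : ℝ) + 1) * (Config.maxLevel 𝓑 𝓢 ε + 1) ^ 2

theorem one_le_decayTime {ε : ℝ} (hε : 0 < ε) : 1 ≤ decayTime 𝓑 𝓢 ε := by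
  have h := Config.maxLevel_nonneg (𝓑 := 𝓑) (𝓢 := 𝓢) hε
  have h1 : (1 : ℝ) ≤ ((Fintype.card 𝓑 + Fintype.card 𝓢 : ℕ) : ℝ) + 1 := by
    linarith [Nat.cast_nonneg (α := ℝ) (Fintype.card 𝓑 + Fintype.card 𝓢)]
  exact one_le_mul_of_one_le_of_one_le h1 (by nlinarith)

/-- The bound `potentialBound` depends only on who is recognized, so averaging over the uniform
choice gives the drift for every behaviour and every past. -/
theorem expect_step_le {σ : Behaviour 𝓑 𝓢} {G : Market 𝓑 𝓢} {ε : ℝ} (hε : 0 < ε)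
    (hG : G.UnitValuations) (hσ : σ.Obeys G ε) (h : History 𝓑 𝓢) {c : Config 𝓑 𝓢}
    (hc : c.Regular G ε) (hne : c.activePlayers.Nonempty) :
    expect ((PMF.uniformOfFinset c.activePlayers hne).bind fun z =>
        (σ h c z).map fun c' => ((c, z) :: h, c')) (fun hc => livePotential ε hc.2) ≤
      ENNReal.ofReal (1 - 1 / decayTime 𝓑 𝓢 ε) * livePotential ε c := by
  have hM := Config.maxLevel_nonneg (𝓑 := 𝓑) (𝓢 := 𝓢) hε
  have hV := hc.one_le_potential hε hne
  have hD := one_le_decayTime (𝓑 := 𝓑) (𝓢 := 𝓢) hε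
  have hr : 0 ≤ 1 - 1 / decayTime 𝓑 𝓢 ε := by
    rw [sub_nonneg, div_le_one (by linarith)]
    exact hD
  rw [expect_bind, expect_uniformOfFinset, livePotential, if_pos hne, ← ENNReal.ofReal_mul hr]
  have h1 : ∀ z ∈ c.activePlayers,
      expect ((σ h c z).map fun c' => ((c, z) :: h, c')) (fun hc => livePotential ε hc.2) ≤
        ENNReal.ofReal (c.potentialBound (Config.maxLevel 𝓑 𝓢 ε) ε z) := by
    intro z hz
    rw [expect_map, ← expect_const (σ h c z) (ENNReal.ofReal _)]
    refine expect_mono fun c' hc' => (livePotential_le ε c').trans (ENNReal.ofReal_le_ofReal ?_)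
    refine hc.potential_move_le hε hG hz (hσ h c z hc.labeled ?_ c' hc')
    simpa [Config.activePlayers] using hz
  have hcard : (0 : ℝ) < c.activePlayers.card := by exact_mod_cast hne.card_pos
  calc _ ≤ (c.activePlayers.card : ℝ≥0∞)⁻¹ * ∑ z ∈ c.activePlayers,
        ENNReal.ofReal (c.potentialBound (Config.maxLevel 𝓑 𝓢 ε) ε z) := by
        gcongr with z hz
        exact h1 z hz
    _ = ENNReal.ofReal ((c.activePlayers.card : ℝ)⁻¹ * ∑ z ∈ c.activePlayers,
        c.potentialBound (Config.maxLevel 𝓑 𝓢 ε) ε z) := by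
        rw [ENNReal.ofReal_mul (by positivity), ENNReal.ofReal_inv_of_pos hcard,
          ENNReal.ofReal_natCast, ENNReal.ofReal_sum_of_nonneg]
        intro z _
        have := (hc.walkPotential_direction_mem hε c.activeB.card c.activeS.card z).1
        unfold Config.potentialBound
        positivity
    _ ≤ _ := by
        apply ENNReal.ofReal_le_ofReal
        rw [inv_mul_le_iff₀ hcard]
        refine (hc.sum_potentialBound_le hε).trans ?_
        gcongr
        have h2 := hc.potential_le hε
        -- The potential is at most `n + 1`, so the additive drift dominates this fraction of it.
        have h3 : 1 / decayTime 𝓑 𝓢 ε * c.potential (Config.maxLevel 𝓑 𝓢 ε) ε ≤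
            1 / (Config.maxLevel 𝓑 𝓢 ε + 1) ^ 2 := by
          rw [one_div_mul_eq_div, div_le_div_iff₀ (by linarith) (by positivity), decayTime]
          nlinarith [sq_nonneg (Config.maxLevel 𝓑 𝓢 ε + 1)]
        linarith

theorem expect_runLaw_le {σ : Behaviour 𝓑 𝓢} {G : Market 𝓑 𝓢} {ε : ℝ} (hε : 0 < ε)
    (hG : G.UnitValuations) (hσ : σ.Obeys G ε) {c₀ : Config 𝓑 𝓢} (h₀ : c₀.Regular G ε) (t : ℕ) :
    expect (runLaw σ c₀ t) (fun hc => livePotential ε hc.2) ≤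
      ENNReal.ofReal (1 - 1 / decayTime 𝓑 𝓢 ε) ^ t * livePotential ε c₀ := by
  induction t with
  | zero => simp [runLaw, expect_pure]
  | succ t ih =>
    rw [runLaw, expect_bind, pow_succ', mul_assoc]
    refine le_trans ?_ (mul_le_mul_right ih _)
    rw [← expect_const_mul]
    refine expect_mono fun hc hsupp => ?_
    have hreg := regular_of_mem_support_runLaw hε hG hσ h₀ t hc hsupp
    split_ifs with hne
    · exact expect_step_le hε hG hσ hc.1 hreg hne
    -- A stopped configuration no longer changes; the cutoff to 0 makes the contraction hold there
    -- as well.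
    · rw [expect_pure, livePotential, if_neg hne]
      exact zero_le

/-- A reachable configuration that has not converged has an active player, hence live potential at
least 1, so Markov's inequality applies. -/
theorem one_sub_le_configLaw_converged {σ : Behaviour 𝓑 𝓢} {G : Market 𝓑 𝓢} {ε : ℝ} (hε : 0 < ε)
    (hG : G.UnitValuations) (hσ : σ.Obeys G ε) {c₀ : Config 𝓑 𝓢} (h₀ : c₀.Regular G ε) (t : ℕ) :
    ENNReal.ofReal (1 - (1 - 1 / decayTime 𝓑 𝓢 ε) ^ t *
        (((Fintype.card 𝓑 + Fintype.card 𝓢 : ℕ) : ℝ) + 1)) ≤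
      (configLaw σ c₀ t).toOuterMeasure (Converged G ε) := by
  have hD := one_le_decayTime (𝓑 := 𝓑) (𝓢 := 𝓢) hε
  have hr : 0 ≤ 1 - 1 / decayTime 𝓑 𝓢 ε := by
    rw [sub_nonneg, div_le_one (by linarith)]
    exact hD
  have h1 : 1 ≤ (configLaw σ c₀ t).toOuterMeasure (Converged G ε) +
      expect (configLaw σ c₀ t) (livePotential ε) := by
    refine one_le_toOuterMeasure_add_expect _ _ _ fun c hc hcon => ?_
    rw [configLaw, PMF.mem_support_map_iff] at hc
    obtain ⟨hc, hsupp, rfl⟩ := hc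
    have hreg := regular_of_mem_support_runLaw hε hG hσ h₀ t hc hsupp
    have hne : hc.2.activePlayers.Nonempty :=
      Finset.nonempty_iff_ne_empty.2 fun he => hcon (hreg.converged he)
    rw [livePotential, if_pos hne, ENNReal.one_le_ofReal]
    exact hreg.one_le_potential hε hne
  have h2 : expect (configLaw σ c₀ t) (livePotential ε) ≤
      ENNReal.ofReal ((1 - 1 / decayTime 𝓑 𝓢 ε) ^ t *
        (((Fintype.card 𝓑 + Fintype.card 𝓢 : ℕ) : ℝ) + 1)) := by
    rw [configLaw, expect_map, ENNReal.ofReal_mul (by positivity), ENNReal.ofReal_pow hr]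
    refine (expect_runLaw_le hε hG hσ h₀ t).trans ?_
    gcongr
    exact (livePotential_le ε c₀).trans (ENNReal.ofReal_le_ofReal (h₀.potential_le hε))
  rw [ENNReal.ofReal_sub _ (by positivity), ENNReal.ofReal_one, tsub_le_iff_right]
  exact h1.trans (by gcongr)

theorem tendsto_configLaw_converged {σ : Behaviour 𝓑 𝓢} {G : Market 𝓑 𝓢} {ε : ℝ} (hε : 0 < ε)
    (hG : G.UnitValuations) (hσ : σ.Obeys G ε) {c₀ : Config 𝓑 𝓢} (h₀ : c₀.Regular G ε) :
    Tendsto (fun t : ℕ => (configLaw σ c₀ t).toOuterMeasure (Converged G ε)) atTop (𝓝 1) := by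
  have hD := one_le_decayTime (𝓑 := 𝓑) (𝓢 := 𝓢) hε
  have hr : 0 ≤ 1 - 1 / decayTime 𝓑 𝓢 ε := by
    rw [sub_nonneg, div_le_one (by linarith)]
    exact hD
  have hr1 : 1 - 1 / decayTime 𝓑 𝓢 ε < 1 := by
    have : 0 < 1 / decayTime 𝓑 𝓢 ε := by positivity
    linarith
  refine tendsto_of_tendsto_of_tendsto_of_le_of_le ?_ tendsto_const_nhds
    (fun t => one_sub_le_configLaw_converged hε hG hσ h₀ t) (fun t => ?_)
  · have h := ((tendsto_pow_atTop_nhds_zero_of_lt_one hr hr1).mul_const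
      (((Fintype.card 𝓑 + Fintype.card 𝓢 : ℕ) : ℝ) + 1)).const_sub 1
    simpa using ENNReal.tendsto_ofReal h
  · change _ ≤ (1 : ℝ≥0∞)
    rw [PMF.toOuterMeasure_apply, ← (configLaw σ c₀ t).tsum_coe]
    exact ENNReal.tsum_le_tsum fun c => Set.indicator_le_self _ _ c

/-! ### Explicit constants. -/

theorem decayTime_le {ε : ℝ} (hε : 0 < ε) {n : ℕ} (hn : n = Fintype.card 𝓑 + Fintype.card 𝓢)
    (hn2 : 2 ≤ n) : decayTime 𝓑 𝓢 ε ≤ 18 * ((n : ℝ) ^ 3 / (min ε 1) ^ 2) := by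
  set m := min ε 1 with hm
  have hm0 : 0 < m := lt_min hε one_pos
  have hm1 : 1 ≤ 1 / m := by
    rw [le_div_iff₀ hm0, one_mul]
    exact min_le_right _ _
  have hn' : (2 : ℝ) ≤ n := by exact_mod_cast hn2
  -- Rounding up costs at most `1 ≤ 1 / m`. This gives `M + 1 ≤ 3n/m`, and with `n + 1 ≤ 2n` the
  -- constant `2 * 3 ^ 2 = 18`.
  have h1 : (⌈1 / ε⌉ : ℝ) ≤ 2 * (1 / m) := by
    have h2 : 1 / ε ≤ 1 / m := one_div_le_one_div_of_le hm0 (min_le_left _ _)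
    linarith [Int.ceil_lt_add_one (1 / ε)]
  have h3 : Config.maxLevel 𝓑 𝓢 ε + 1 ≤ 3 * n * (1 / m) := by
    rw [Config.maxLevel, ← hn]
    nlinarith
  have h4 := Config.maxLevel_nonneg (𝓑 := 𝓑) (𝓢 := 𝓢) hε
  calc decayTime 𝓑 𝓢 ε = ((n : ℝ) + 1) * (Config.maxLevel 𝓑 𝓢 ε + 1) ^ 2 := by
        rw [decayTime, ← hn]
    _ ≤ (2 * n) * (3 * n * (1 / m)) ^ 2 := by
        gcongr
        linarith
    _ = 18 * ((n : ℝ) ^ 3 / m ^ 2) := by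
        field_simp
        ring

/-- By `1 - 1/D ≤ exp(-1/D)` the power is at most `n⁻³`, and `n + 1 ≤ n²` for `n ≥ 2`. -/
theorem pow_decay_le {D : ℝ} (hD : 1 ≤ D) {n : ℕ} (hn : 2 ≤ n) {t : ℕ}
    (ht : 3 * D * Real.log n ≤ t) : (1 - 1 / D) ^ t * ((n : ℝ) + 1) ≤ 1 / n := by
  have hn' : (2 : ℝ) ≤ n := by exact_mod_cast hn
  have hn0 : (0 : ℝ) < n := by linarith
  have hr : 0 ≤ 1 - 1 / D := by
    rw [sub_nonneg, div_le_one (by linarith)]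
    exact hD
  have h1 : (1 - 1 / D) ^ t ≤ 1 / (n : ℝ) ^ 3 := by
    calc (1 - 1 / D) ^ t ≤ Real.exp (-(1 / D)) ^ t := by
          gcongr
          linarith [Real.add_one_le_exp (-(1 / D))]
      _ = Real.exp (-(t / D)) := by
          rw [← Real.exp_nat_mul]
          congr 1
          ring
      _ ≤ Real.exp (-(3 * Real.log n)) := by
          gcongr
          rw [le_div_iff₀ (by linarith)]
          linarith
      _ = 1 / (n : ℝ) ^ 3 := by
          rw [Real.exp_neg, one_div, mul_comm, Real.exp_mul, Real.exp_log hn0]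
          norm_cast
  calc (1 - 1 / D) ^ t * ((n : ℝ) + 1) ≤ 1 / (n : ℝ) ^ 3 * (n : ℝ) ^ 2 := by
        gcongr
        nlinarith
    _ = 1 / n := by
        field_simp

end Run

end DoubleAuction

theorem mainTheorem2 :
    ∃ C : ℝ, 0 < C ∧
      ∀ (𝓑 : Type*) (𝓢 : Type*) [Fintype 𝓑] [Fintype 𝓢]
        (G : DoubleAuction.Market 𝓑 𝓢), G.UnitValuations →
      ∀ ε : ℝ, 0 < ε →
      ∀ x₀ : DoubleAuction.MarketState 𝓑 𝓢, x₀.IsValidStart G ε →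
      ∀ σ : DoubleAuction.Behaviour 𝓑 𝓢, σ.Obeys G ε →
        Tendsto (fun t : ℕ =>
            (DoubleAuction.configLaw σ (DoubleAuction.Config.start G ε x₀) t).toOuterMeasure
              (DoubleAuction.Converged G ε)) atTop (𝓝 1) ∧
        ∀ n : ℕ, n = Fintype.card 𝓑 + Fintype.card 𝓢 → 2 ≤ n →
          ∀ t : ℕ, C * ((n : ℝ) ^ 3 / (min ε 1) ^ 2 * Real.log n) ≤ (t : ℝ) →
            ENNReal.ofReal (1 - 1 / (n : ℝ)) ≤
              (DoubleAuction.configLaw σ (DoubleAuction.Config.start G ε x₀) t).toOuterMeasure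
                (DoubleAuction.Converged G ε) := by
  -- Here `54 = 3 * 18`, from `pow_decay_le` and `decayTime_le`.
  refine ⟨54, by norm_num, fun 𝓑 𝓢 _ _ G hG ε hε x₀ hx₀ σ hσ => ?_⟩
  have h₀ := DoubleAuction.Config.regular_start hε hx₀
  refine ⟨DoubleAuction.tendsto_configLaw_converged hε hG hσ h₀, fun n hn hn2 t ht => ?_⟩
  refine le_trans (ENNReal.ofReal_le_ofReal ?_)
    (DoubleAuction.one_sub_le_configLaw_converged hε hG hσ h₀ t)
  have hlog : 0 ≤ Real.log n := Real.log_natCast_nonneg n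
  have hD := DoubleAuction.decayTime_le (𝓑 := 𝓑) (𝓢 := 𝓢) hε hn hn2
  have h := DoubleAuction.pow_decay_le (DoubleAuction.one_le_decayTime (𝓑 := 𝓑) (𝓢 := 𝓢) hε) hn2
    (t := t) (by nlinarith [mul_le_mul_of_nonneg_right hD hlog])
  rw [← hn]
  linarith
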